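/- **Hyperbolic Denjoy–Yoccoz Lemma.** *Notation.* For $\Delta>0$ let $B_\Delta=\{z\in\mathbb C:|\operatorname{Im} z|<\Delta\}$. Let $D^\omega(\mathbb T)$ be the set of nondecreasing real-analytic diffeomorphisms $g$ of $\mathbb R$ with $g(x+1)=g(x)+1$, and let $D^\omega(\mathbb T,\Delta)$ be the set of those $g\in D^\omega(\mathbb T)$ that extend to a holomorphic diffeomorphism, again denoted $g$, between open subsets of $\mathbb C$ such that $g$ and $g^{-1}$ are both defined on $B_\Delta$. Suppose $g$ has irrational rotation number $\alpha$, and let $(p_n/q_n)_{n\ge 0}$ be the convergents of $\alpha$. Put $m_n(x)=g^{q_n}(x)-x-p_n$. If $h:\mathbb R\to\mathbb R$ is an increasing homeomorphism with $h(x+1)=h(x)+1$ and $h^{-1}\circ g\circ h(x)=x+\alpha$, put $\varphi_t(x)=h(h^{-1}(x)+t\alpha)$ for $t\in\mathbb R$, and for $z_0=x_0+i\,|m_n(x_0)|\,y_0$ with $x_0,y_0\in\mathbb R$ put $$\varphi^{(n)}_t(z_0)=\varphi_t(x_0)+i\,|m_n(\varphi_t(x_0))|\,y_0 .$$ Let $d_P$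 be the Poincaré distance of the upper half-plane, given by the metric $|d\xi|/\operatorname{Im}\xi$. *Statement.* There are universal constants $0<\varepsilon_0<\frac1{16}$ and $C_0>0$ such that the following holds. Let $4<D_0<\frac1{4\varepsilon_0}$, let $\Delta>0$, and let $g\in D^\omega(\mathbb T,\Delta)$ have irrational rotation number, be holomorphic on $B_\Delta$ and continuous on $\overline{B_\Delta}$, and satisfy $\sup_{B_\Delta}|D\log Dg|<\varepsilon_0$. Then a homeomorphism $h$ as above exists, and there is $n_0\ge 1$ such that for every such $h$, every $n>n_0$, every $z_0=x_0+i\,|m_n(x_0)|\,y_0$ with $x_0\in\mathbb R$ and $0<y_0<D_0$, and every $0\le j\le q_{n+1}$: the points $z_0,g(z_0),\dots,g^{j-1}(z_0)$ lie in $B_\Delta$ (so that $g^j(z_0)$ is defined), the points $g^j(z_0)$ and $\varphi^{(n)}_j(z_0)$ lie in the upper half-plane, and $$d_P\bigl(g^j(z_0),\varphi^{(n)}_j(z_0)\bigr)\le C_0 .$$ -/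

import Mathlib

namespace CircleDynamics

open Set

/-- The open strip `B_Δ = {z : |Im z| < Δ}`. -/
def strip (Δ : ℝ) : Set ℂ := {z | |z.im| < Δ}

/-- Orientation preserving real-analytic diffeomorphisms of the circle, as lifts to the line:
nondecreasing maps `g` with `g (x + 1) = g x + 1` (bundled in `CircleDeg1Lift`) that are
real-analytic and have a real-analytic inverse. -/
def IsAnalyticCircleDiffeo (g : CircleDeg1Lift) : Prop :=
  AnalyticOnNhd ℝ g univ ∧
    ∃ k : ℝ → ℝ, Function.LeftInverse k g ∧ Function.RightInverse k g ∧ AnalyticOnNhd ℝ k univ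

/-- `G` is a holomorphic diffeomorphism, from an open set `U` onto its image, which extends the
circle diffeomorphism `g` and is such that both `G` and `G⁻¹` are defined on `B_Δ`.
(An injective holomorphic map on an open set has a holomorphic inverse on its image.) -/
def IsHolomorphicExtension (g : CircleDeg1Lift) (Δ : ℝ) (G : ℂ → ℂ) : Prop :=
  (∀ x : ℝ, G x = (g x : ℂ)) ∧
    ∃ U : Set ℂ, IsOpen U ∧ strip Δ ⊆ U ∧ DifferentiableOn ℂ G U ∧ InjOn G U ∧
      strip Δ ⊆ G '' U

/-- The supremum norm `‖D log DG‖` on the strip, where `D log DG = G'' / G'`. The supremum is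
taken over the open strip; for a function that is continuous on the closed strip this is
its supremum over the closed strip. -/
noncomputable def nonlinearityNorm (Δ : ℝ) (G : ℂ → ℂ) : ENNReal :=
  ⨆ z ∈ strip Δ, ‖logDeriv (deriv G) z‖ₑ

/-- The numerator `p_n` of the `n`-th convergent of `α` (so `p_0 / q_0 = ⌊α⌋ / 1`). -/
noncomputable def convNum (α : ℝ) (n : ℕ) : ℤ := (Real.convergent α n).num

/-- The denominator `q_n` of the `n`-th convergent of `α`. -/
noncomputable def convDen (α : ℝ) (n : ℕ) : ℕ := (Real.convergent α n).den

/-- `m_n (x) = g^{q_n} (x) - x - p_n`, where `p_n / q_n` are the convergents of the rotation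
number of `g`. -/
noncomputable def displacement (g : CircleDeg1Lift) (n : ℕ) (x : ℝ) : ℝ :=
  g^[convDen g.translationNumber n] x - x - convNum g.translationNumber n

/-- `h` is an increasing homeomorphism of the line, commuting with `x ↦ x + 1`, with
`h⁻¹ ∘ g ∘ h` equal to the translation by the rotation number of `g`. -/
def IsLinearization (g : CircleDeg1Lift) (h : ℝ ≃o ℝ) : Prop :=
  (∀ x, h (x + 1) = h x + 1) ∧ ∀ x, h.symm (g (h x)) = x + g.translationNumber

/-- The real flow `φ_t = h ∘ T_{tα} ∘ h⁻¹`, with `α` the rotation number of `g`. -/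
noncomputable def realFlow (g : CircleDeg1Lift) (h : ℝ ≃o ℝ) (t x : ℝ) : ℝ :=
  h (h.symm x + t * g.translationNumber)

/-- The complex flow
`φ_t^{(n)} (x₀ + i |m_n (x₀)| y₀) = φ_t (x₀) + i |m_n (φ_t (x₀))| y₀`, where `y₀` is recovered
from `z₀` as `Im z₀ / |m_n (Re z₀)|` (`m_n` has no zero when the rotation number is
irrational). -/
noncomputable def complexFlow (g : CircleDeg1Lift) (h : ℝ ≃o ℝ) (n : ℕ) (t : ℝ) (z : ℂ) : ℂ :=
  ⟨realFlow g h t z.re,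
    |displacement g n (realFlow g h t z.re)| * (z.im / |displacement g n z.re|)⟩

end CircleDynamics

/-!
The proof is Denjoy's distortion argument, carried out on the real line and then on vertical
segments of the strip.

Since `D log DG` is bounded by `ε` on the strip, `log DG` is `ε`-Lipschitz there
(`NonlinearityBound.exists_deriv_eq_mul_exp`). Hence `log D(G^j)` varies between two points by at
most `ε` times the sum of the distances between their orbits, and everything reduces to bounding
such sums. On the real line they are sums of lengths of arcs that are disjoint on the circle, hence
at most `1`: by the law of best approximation (`abs_convErr_le_of_lt`) the first `q_{n+1}` iterates
of a closest return arc `[x, g^{q_n} x - p_n]` do not overlap, so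
`∑_{i < q_{n+1}} |m_n(g^i x)| ≤ 1` (`IsLinearization.sum_abs_displacement_le_one`).

Two consequences hold on the real line. First, no arc is collapsed by the semiconjugacy to the
rotation, so that `g` is linearizable (Denjoy's theorem, `IsSemilinearization.strictMono`), and then
`m_n` tends to zero uniformly. Secondly, `|m_n(g^j x)|` is `(g^j)'(x) |m_n(x)|` up to a factor `e^ε`
(`NonlinearityBound.abs_displacement_iterate_comparison`).

In the complex domain, take the vertical segment of height `D₀ |m_n(x₀)|` above `x₀`. As long as
`log D(G^i)` oscillates by at most `2 / 5` on it, its image under `G^i` is within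
`(8 / 5) D₀ |m_n(g^i x₀)|` of `g^i x₀`. Summing over `i`, the oscillation is at most
`(8 / 5) ε D₀ ≤ 2 / 5`, because `ε D₀ ≤ 1 / 4`, so the bound propagates up to time `q_{n+1}`
(`NonlinearityBound.iterate_verticalSegment`). Therefore
`G^j(x₀ + i s) = g^j x₀ + i s (g^j)'(x₀) (1 + η)` with `|η| ≤ 14 / 25`, and the comparison of
`|m_n(g^j x₀)|` with `(g^j)'(x₀) |m_n(x₀)|` bounds the hyperbolic distance to the flow by `1`.
-/

namespace CircleDynamics

open Set Filter Topology

/-! ### Convergents and the law of best approximation -/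

theorem one_lt_inv_fract {α : ℝ} (hα : Irrational α) : 1 < (Int.fract α)⁻¹ := by
  have h0 : 0 < Int.fract α := by
    rw [Int.fract_pos]
    exact fun h => hα ⟨⌊α⌋, by rw [h]; simp⟩
  exact (one_lt_inv₀ h0).2 (Int.fract_lt_one α)

theorem irrational_inv_fract {α : ℝ} (hα : Irrational α) : Irrational (Int.fract α)⁻¹ := by
  have h : Irrational (α - ⌊α⌋) := hα.sub_intCast _
  exact h.inv

@[simp] theorem convNum_zero (α : ℝ) : convNum α 0 = ⌊α⌋ := by simp [convNum]

@[simp] theorem convDen_zero (α : ℝ) : convDen α 0 = 1 := by simp [convDen]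

theorem convDen_pos (α : ℝ) (n : ℕ) : 0 < convDen α n := Rat.den_pos _

/-- Adding an integer to the inverse of a positive reduced fraction leaves it reduced. -/
theorem num_den_add_inv (a : ℤ) {r : ℚ} (hr : 0 < r.num) :
    ((a : ℚ) + r⁻¹).num = a * r.num + r.den ∧ (((a : ℚ) + r⁻¹).den : ℤ) = r.num := by
  have hcop : IsCoprime (a * r.num + r.den) r.num := by
    have : IsCoprime (r.den : ℤ) r.num := (Rat.isCoprime_num_den r).symm
    rw [add_comm]
    exact IsCoprime.add_mul_right_left this a
  have hcop' := Int.isCoprime_iff_gcd_eq_one.1 hcop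
  have heq : (a : ℚ) + r⁻¹ = ((a * r.num + r.den : ℤ) : ℚ) / (r.num : ℤ) := by
    have h1 : (r.num : ℚ) ≠ 0 := by exact_mod_cast hr.ne'
    have h2 : r⁻¹ = (r.den : ℚ) / r.num := by
      conv_lhs => rw [← Rat.num_div_den r]
      rw [inv_div]
    rw [h2]; push_cast; field_simp
  rw [heq]
  exact ⟨Rat.num_div_eq_of_coprime hr hcop', Rat.den_div_eq_of_coprime hr hcop'⟩

theorem convNum_pos {β : ℝ} (hβ : Irrational β) (h1 : 1 < β) (n : ℕ) : 0 < convNum β n := by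
  induction n generalizing β with
  | zero =>
    rw [convNum_zero]
    exact Int.floor_pos.2 h1.le
  | succ n ih =>
    have hp := ih (irrational_inv_fract hβ) (one_lt_inv_fract hβ)
    have hf : 0 < ⌊β⌋ := Int.floor_pos.2 h1.le
    rw [convNum, Real.convergent_succ, (num_den_add_inv _ hp).1]
    have := Rat.den_pos ((Int.fract β)⁻¹.convergent n)
    change 0 < _ * convNum _ n + _
    positivity

/-- The convergents of `α` are obtained from those of the next complete quotient `β = 1 / {α}` by
`p_{n+1}(α) = ⌊α⌋ p_n(β) + q_n(β)` and `q_{n+1}(α) = p_n(β)`. -/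
theorem convNum_succ {α : ℝ} (hα : Irrational α) (n : ℕ) :
    convNum α (n + 1) = ⌊α⌋ * convNum (Int.fract α)⁻¹ n + convDen (Int.fract α)⁻¹ n := by
  have hp := convNum_pos (irrational_inv_fract hα) (one_lt_inv_fract hα) n
  rw [convNum, Real.convergent_succ, (num_den_add_inv _ hp).1]
  rfl

theorem convDen_succ {α : ℝ} (hα : Irrational α) (n : ℕ) :
    (convDen α (n + 1) : ℤ) = convNum (Int.fract α)⁻¹ n := by
  have hp := convNum_pos (irrational_inv_fract hα) (one_lt_inv_fract hα) n
  rw [convDen, Real.convergent_succ, (num_den_add_inv _ hp).2]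
  rfl

/-- Consecutive convergents satisfy `p_{n+1} q_n - p_n q_{n+1} = (-1)^n`. -/
theorem conv_det {α : ℝ} (hα : Irrational α) (n : ℕ) :
    convNum α (n + 1) * convDen α n - convNum α n * convDen α (n + 1) = (-1) ^ n := by
  induction n generalizing α with
  | zero => simp [convNum_succ hα, convDen_succ hα, mul_comm]
  | succ n ih =>
    have h := ih (irrational_inv_fract hα)
    rw [convNum_succ hα, convNum_succ hα, convDen_succ hα, convDen_succ hα, pow_succ, ← h]
    ring

/-- The signed error `q_n α - p_n` of the `n`-th convergent. -/
noncomputable def convErr (α : ℝ) (n : ℕ) : ℝ := convDen α n * α - convNum α n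

theorem convErr_succ {α : ℝ} (hα : Irrational α) (n : ℕ) :
    convErr α (n + 1) = -(Int.fract α * convErr (Int.fract α)⁻¹ n) := by
  have h2 : (convDen α (n + 1) : ℝ) = convNum (Int.fract α)⁻¹ n := by
    exact_mod_cast convDen_succ hα n
  have h0 : Int.fract α ≠ 0 := fun h => by
    have := one_lt_inv_fract hα
    rw [h] at this; norm_num at this
  have h3 : α = ⌊α⌋ + Int.fract α := (Int.floor_add_fract α).symm
  rw [convErr, convErr, h2, convNum_succ hα]
  push_cast
  set f := Int.fract α
  rw [show (convNum f⁻¹ n : ℝ) * α = convNum f⁻¹ n * (⌊α⌋ + f) by rw [← h3]]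
  field_simp
  ring

/-- The errors of consecutive convergents alternate in sign. -/
theorem neg_one_pow_mul_convErr_pos {α : ℝ} (hα : Irrational α) (n : ℕ) :
    0 < (-1) ^ n * convErr α n := by
  induction n generalizing α with
  | zero =>
    have := one_lt_inv_fract hα
    have h0 : 0 < Int.fract α := inv_pos.1 (by linarith)
    simpa [convErr] using h0
  | succ n ih =>
    have h := ih (irrational_inv_fract hα)
    have := one_lt_inv_fract hα
    have h0 : 0 < Int.fract α := inv_pos.1 (by linarith)
    rw [convErr_succ hα, pow_succ]
    calc 0 < Int.fract α * ((-1) ^ n * convErr (Int.fract α)⁻¹ n) := mul_pos h0 h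
      _ = _ := by ring

theorem abs_convErr {α : ℝ} (hα : Irrational α) (n : ℕ) :
    |convErr α n| = (-1) ^ n * convErr α n := by
  rw [← abs_of_pos (neg_one_pow_mul_convErr_pos hα n), abs_mul, abs_pow]
  simp

theorem convErr_ne_zero {α : ℝ} (hα : Irrational α) (n : ℕ) : convErr α n ≠ 0 := fun h => by
  simpa [h] using neg_one_pow_mul_convErr_pos hα n

theorem convNum_lt_and_convDen_le {β : ℝ} (hβ : Irrational β) (h1 : 1 < β) (n : ℕ) :
    convNum β n < convNum β (n + 1) ∧ convDen β n ≤ convDen β (n + 1) := by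
  induction n generalizing β with
  | zero =>
    have hγ := one_lt_inv_fract hβ
    have hf : 0 < ⌊β⌋ := Int.floor_pos.2 h1.le
    have hf' : 0 < ⌊(Int.fract β)⁻¹⌋ := Int.floor_pos.2 hγ.le
    refine ⟨?_, convDen_pos β _⟩
    rw [convNum_succ hβ]
    simp
    nlinarith
  | succ n ih =>
    obtain ⟨h2, h3⟩ := ih (irrational_inv_fract hβ) (one_lt_inv_fract hβ)
    have hf : 0 < ⌊β⌋ := Int.floor_pos.2 h1.le
    constructor
    · rw [convNum_succ hβ, convNum_succ hβ]
      have : (convDen (Int.fract β)⁻¹ n : ℤ) ≤ convDen (Int.fract β)⁻¹ (n + 1) := by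
        exact_mod_cast h3
      nlinarith
    · have := convDen_succ hβ n
      have := convDen_succ hβ (n + 1)
      omega

theorem convDen_succ_lt {α : ℝ} (hα : Irrational α) (n : ℕ) :
    convDen α (n + 1) < convDen α (n + 2) := by
  have := (convNum_lt_and_convDen_le (irrational_inv_fract hα) (one_lt_inv_fract hα) n).1
  have := convDen_succ hα n
  have : (convDen α (n + 2) : ℤ) = _ := convDen_succ hα (n + 1)
  omega

theorem convDen_le_succ {α : ℝ} (hα : Irrational α) (n : ℕ) :
    convDen α n ≤ convDen α (n + 1) := by
  cases n with
  | zero => exact convDen_pos α _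
  | succ n => exact (convDen_succ_lt hα n).le

theorem lt_convDen_succ {α : ℝ} (hα : Irrational α) (n : ℕ) : n < convDen α (n + 1) := by
  induction n with
  | zero => exact convDen_pos α _
  | succ n ih => exact lt_of_le_of_lt ih (convDen_succ_lt hα n)

theorem convDen_mul_abs_convErr_add {α : ℝ} (hα : Irrational α) (n : ℕ) :
    convDen α n * |convErr α (n + 1)| + convDen α (n + 1) * |convErr α n| = 1 := by
  have h : ((convNum α (n + 1) * convDen α n - convNum α n * convDen α (n + 1) : ℤ) : ℝ)
      = (-1) ^ n := by rw [conv_det hα]; simp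
  push_cast at h
  have h2 : ((-1 : ℝ) ^ n) * (-1) ^ n = 1 := by rw [← mul_pow]; simp
  rw [abs_convErr hα, abs_convErr hα, convErr, convErr, pow_succ]
  calc _ = (-1) ^ n *
          ((convNum α (n + 1) * convDen α n - convNum α n * convDen α (n + 1) : ℝ)) := by ring
    _ = 1 := by rw [h, h2]

theorem abs_convErr_le {α : ℝ} (hα : Irrational α) (n : ℕ) :
    |convErr α n| ≤ 1 / convDen α (n + 1) := by
  have h := convDen_mul_abs_convErr_add hα n
  have hq : (0 : ℝ) < convDen α (n + 1) := by exact_mod_cast convDen_pos α _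
  rw [le_div_iff₀ hq]
  have : 0 ≤ (convDen α n : ℝ) * |convErr α (n + 1)| := by positivity
  linarith

theorem abs_convErr_lt_one {α : ℝ} (hα : Irrational α) (n : ℕ) : |convErr α n| < 1 := by
  have h := convDen_mul_abs_convErr_add hα n
  have hq : (1 : ℝ) ≤ convDen α (n + 1) := by exact_mod_cast convDen_pos α _
  have hq' : (0 : ℝ) < convDen α n := by exact_mod_cast convDen_pos α _
  have := mul_pos hq' (abs_pos.2 (convErr_ne_zero hα (n + 1)))
  nlinarith [abs_nonneg (convErr α n)]

/-- Law of best approximation. The pair `(d, k)` is an integral combination of `(q_n, p_n)` and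
`(q_{n+1}, p_{n+1})`; since `0 < d < q_{n+1}` its coefficients have opposite signs, and the two
errors have opposite signs too, so the contributions add up. -/
theorem abs_convErr_le_of_lt {α : ℝ} (hα : Irrational α) (n : ℕ) {d k : ℤ} (hd : 0 < d)
    (hdq : d < convDen α (n + 1)) : |convErr α n| ≤ |d * α - k| := by
  obtain ⟨s, hs, hs'⟩ : ∃ s : ℤ, s = (-1) ^ n ∧ s * s = 1 :=
    ⟨_, rfl, by rw [← mul_pow]; simp⟩
  have hdet := conv_det hα n
  rw [← hs] at hdet
  set q : ℤ := (convDen α n : ℤ) with hq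
  set q' : ℤ := (convDen α (n + 1) : ℤ) with hq'
  set p := convNum α n with hp
  set p' := convNum α (n + 1) with hp'
  have hq0 : 0 < q := Int.natCast_pos.2 (convDen_pos α n)
  have hq0' : 0 < q' := Int.natCast_pos.2 (convDen_pos α (n + 1))
  obtain ⟨x, y, hx, hy⟩ : ∃ x y : ℤ, d = x * q + y * q' ∧ k = x * p + y * p' := by
    refine ⟨s * (p' * d - q' * k), s * (q * k - p * d), ?_, ?_⟩
    · linear_combination (-d) * hs' - s * d * hdet
    · linear_combination (-k) * hs' - s * k * hdet
  have hx0 : x ≠ 0 := by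
    rintro rfl
    rcases le_or_gt y 0 with h | h <;> nlinarith
  have hxy : x * y ≤ 0 := by
    by_contra! h
    rcases pos_and_pos_or_neg_and_neg_of_mul_pos h with ⟨h1, h2⟩ | ⟨h1, h2⟩
    · nlinarith
    · nlinarith
  have hval : (d : ℝ) * α - k = x * convErr α n + y * convErr α (n + 1) := by
    have e1 : (q : ℝ) = convDen α n := by simp [hq]
    have e2 : (q' : ℝ) = convDen α (n + 1) := by simp [hq']
    rw [convErr, convErr, hx, hy]
    push_cast
    rw [e1, e2]
    ring
  set e := convErr α n
  set e' := convErr α (n + 1)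
  have hee : e * e' ≤ 0 := by
    have h1 := neg_one_pow_mul_convErr_pos hα n
    have h2 := neg_one_pow_mul_convErr_pos hα (n + 1)
    have h3 := mul_pos h1 h2
    have h4 : ((-1 : ℝ) ^ n) * (-1) ^ n = 1 := by rw [← mul_pow]; simp
    have : (-1 : ℝ) ^ n * e * ((-1) ^ (n + 1) * e') = -(e * e') := by
      rw [pow_succ]; linear_combination (-(e * e')) * h4
    linarith
  have hx1 : (1 : ℝ) ≤ |(x : ℝ)| := by exact_mod_cast Int.one_le_abs hx0
  have hprod : 0 ≤ (x * e) * (y * e') := by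
    have h5 : (x : ℝ) * y ≤ 0 := by exact_mod_cast hxy
    nlinarith
  rw [hval]
  calc |e| ≤ |(x : ℝ)| * |e| := le_mul_of_one_le_left (abs_nonneg _) hx1
    _ = |x * e| := (abs_mul _ _).symm
    _ ≤ |x * e + y * e'| := by
      apply sq_le_sq.1
      nlinarith [sq_nonneg (y * e')]

/-- Away from `d = q_n` the inequality of best approximation is strict. -/
theorem abs_convErr_lt_of_lt {α : ℝ} (hα : Irrational α) (n : ℕ) {d k : ℤ} (hd : 0 < d)
    (hdq : d < convDen α n) : |convErr α n| < |d * α - k| := by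
  have hdq' : d < convDen α (n + 1) :=
    hdq.trans_le (by exact_mod_cast convDen_le_succ hα n)
  refine lt_of_le_of_ne (abs_convErr_le_of_lt hα n hd hdq') fun h => ?_
  rw [convErr] at h
  have key : ∀ a b : ℤ, (a : ℝ) * α = b → a = 0 := by
    intro a b hab
    by_contra h0
    exact hα ⟨b / a, by
      have : (a : ℝ) ≠ 0 := by exact_mod_cast h0
      push_cast; field_simp; linarith⟩
  rcases abs_eq_abs.1 h with h | h
  · have := key (convDen α n - d) (convNum α n - k) (by push_cast; linarith)
    omega
  · have := key (convDen α n + d) (convNum α n + k) (by push_cast; linarith)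
    omega

/-! ### Disjoint arcs on the circle -/

/-- Half-open intervals whose integer translates are pairwise disjoint project to disjoint arcs of
the circle, so their total length is at most one. -/
theorem sum_length_le_one {ι : Type*} (s : Finset ι) (u v : ι → ℝ) (huv : ∀ i ∈ s, u i < v i)
    (hdisj : ∀ i ∈ s, ∀ j ∈ s, ∀ k : ℤ, (i ≠ j ∨ k ≠ 0) → ∀ x, u i ≤ x → x < v i →
      u j + k ≤ x → x < v j + k → False) :
    ∑ i ∈ s, (v i - u i) ≤ 1 := by
  classical
  rcases s.eq_empty_or_nonempty with rfl | ⟨o, ho⟩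
  · simp
  -- Translate every interval so that it starts in the fundamental domain `[u o, u o + 1)`.
  let c : ι → ℤ := fun i => ⌊u i - u o⌋
  have hc1 : ∀ i, u o ≤ u i - c i := fun i => by
    have := Int.floor_le (u i - u o); simp only [c]; linarith
  have hc2 : ∀ i, u i - c i < u o + 1 := fun i => by
    have := Int.lt_floor_add_one (u i - u o); simp only [c]; linarith
  have hv : ∀ i ∈ s, v i - c i ≤ u o + 1 := by
    intro i hi
    by_contra! h
    refine hdisj i hi o ho (1 + c i) ?_ (u o + 1 + c i) ?_ ?_ ?_ ?_
    · by_cases hio : i = o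
      · right; subst hio; simp [c]
      · exact Or.inl hio
    · have := hc2 i; linarith
    · linarith
    · push_cast; linarith
    · have := huv o ho; push_cast; linarith
  have hd : (s : Set ι).PairwiseDisjoint fun i => Ico (u i - c i) (v i - c i) := by
    intro i hi j hj hij
    refine Set.disjoint_left.2 fun x hx hy => ?_
    refine hdisj i hi j hj (c i - c j) (Or.inl hij) (x + c i) ?_ ?_ ?_ ?_
    · linarith [hx.1]
    · linarith [hx.2]
    · push_cast; linarith [hy.1]
    · push_cast; linarith [hy.2]
  have hm := MeasureTheory.measure_biUnion_finset (μ := MeasureTheory.volume) hd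
    (fun i _ => measurableSet_Ico)
  have hsub : (⋃ i ∈ s, Ico (u i - c i) (v i - c i)) ⊆ Ico (u o) (u o + 1) := by
    refine iUnion₂_subset fun i hi x hx => ⟨(hc1 i).trans hx.1, hx.2.trans_le (hv i hi)⟩
  have hle := MeasureTheory.measure_mono (μ := MeasureTheory.volume) hsub
  rw [hm] at hle
  simp only [Real.volume_Ico] at hle
  rw [← ENNReal.ofReal_sum_of_nonneg (fun i hi => by have := huv i hi; linarith),
    ENNReal.ofReal_le_ofReal_iff (by linarith)] at hle
  simpa using hle

/-- Distinct points among the first `q_{n+1}` points of a rotation orbit are at distance at least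
`|q_n α - p_n|` modulo one. -/
theorem abs_convErr_le_sub {α : ℝ} (hα : Irrational α) (n : ℕ) {i j : ℕ} {k : ℤ}
    (hi : i < convDen α (n + 1)) (hj : j < convDen α (n + 1)) (h : i ≠ j ∨ k ≠ 0) :
    |convErr α n| ≤ |(i - j) * α - k| := by
  rcases lt_trichotomy i j with hij | rfl | hij
  · have := abs_convErr_le_of_lt hα n (d := j - i) (k := -k) (by omega) (by omega)
    rw [abs_sub_comm]
    convert this using 2
    push_cast; ring
  · have hk : k ≠ 0 := by simpa using h
    have h1 : (1 : ℝ) ≤ |(k : ℝ)| := by exact_mod_cast Int.one_le_abs hk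
    have := abs_convErr_lt_one hα n
    simp only [sub_self, zero_mul, zero_sub, abs_neg]
    linarith
  · have := abs_convErr_le_of_lt hα n (d := i - j) (k := k) (by omega) (by omega)
    convert this using 2
    push_cast; ring

/-- Among the first `q_n` points the separation is strictly larger than `|q_n α - p_n|`. -/
theorem abs_convErr_lt_sub {α : ℝ} (hα : Irrational α) (n : ℕ) {i j : ℕ} {k : ℤ}
    (hi : i < convDen α n) (hj : j < convDen α n) (h : i ≠ j ∨ k ≠ 0) :
    |convErr α n| < |(i - j) * α - k| := by
  rcases lt_trichotomy i j with hij | rfl | hij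
  · have := abs_convErr_lt_of_lt hα n (d := j - i) (k := -k) (by omega) (by omega)
    rw [abs_sub_comm]
    convert this using 2
    push_cast; ring
  · have hk : k ≠ 0 := by simpa using h
    have h1 : (1 : ℝ) ≤ |(k : ℝ)| := by exact_mod_cast Int.one_le_abs hk
    have := abs_convErr_lt_one hα n
    simp only [sub_self, zero_mul, zero_sub, abs_neg]
    linarith
  · have := abs_convErr_lt_of_lt hα n (d := i - j) (k := k) (by omega) (by omega)
    convert this using 2
    push_cast; ring

/-! ### Distortion in the strip and along real orbits -/

/-- `G` is a holomorphic extension of `g` to the strip `B_Δ`, without critical points on the real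
line, whose nonlinearity `D log DG` is bounded by `ε` on the strip. -/
structure NonlinearityBound (g : CircleDeg1Lift) (Δ ε : ℝ) (G : ℂ → ℂ) : Prop where
  pos : 0 < Δ
  map_real : ∀ x : ℝ, G x = (g x : ℂ)
  differentiableOn : DifferentiableOn ℂ G (strip Δ)
  norm_logDeriv_le : ∀ z ∈ strip Δ, ‖logDeriv (deriv G) z‖ ≤ ε
  deriv_real_ne_zero : ∀ x : ℝ, deriv G x ≠ 0

theorem isOpen_strip (Δ : ℝ) : IsOpen (strip Δ) :=
  isOpen_lt (by fun_prop) continuous_const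

theorem convex_strip (Δ : ℝ) : Convex ℝ (strip Δ) := by
  have : strip Δ = Complex.imLm ⁻¹' Ioo (-Δ) Δ := by
    ext z; simp [strip, abs_lt]
  rw [this]
  exact (convex_Ioo _ _).is_linear_preimage Complex.imLm.isLinear

theorem ofReal_mem_strip {Δ : ℝ} (hΔ : 0 < Δ) (x : ℝ) : (x : ℂ) ∈ strip Δ := by
  simpa [strip] using hΔ

namespace NonlinearityBound

variable {g : CircleDeg1Lift} {Δ ε : ℝ} {G : ℂ → ℂ}

theorem differentiableOn_deriv (hG : NonlinearityBound g Δ ε G) :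
    DifferentiableOn ℂ (deriv G) (strip Δ) :=
  hG.differentiableOn.deriv (isOpen_strip Δ)

theorem nonneg (hG : NonlinearityBound g Δ ε G) : 0 ≤ ε :=
  (norm_nonneg _).trans (hG.norm_logDeriv_le _ (ofReal_mem_strip hG.pos 0))

/-- The bound `|G''| ≤ ε |G'|` also holds at a zero of `G'`, where the logarithmic derivative takes
a junk value: such a zero is isolated, so the bound passes to the limit, or `G'` vanishes nearby. -/
theorem norm_deriv_deriv_le (hG : NonlinearityBound g Δ ε G) {z : ℂ} (hz : z ∈ strip Δ) :
    ‖deriv (deriv G) z‖ ≤ ε * ‖deriv G z‖ := by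
  have hoff : ∀ w ∈ strip Δ, deriv G w ≠ 0 → ‖deriv (deriv G) w‖ ≤ ε * ‖deriv G w‖ := by
    intro w hw h0
    have := hG.norm_logDeriv_le w hw
    rwa [logDeriv_apply, norm_div, div_le_iff₀ (norm_pos_iff.2 h0)] at this
  have hnhds := (isOpen_strip Δ).mem_nhds hz
  have han : AnalyticAt ℂ (deriv G) z := hG.differentiableOn_deriv.analyticAt hnhds
  rcases han.eventually_eq_zero_or_eventually_ne_zero with h | h
  · have h1 : deriv (deriv G) z = 0 := by
      rw [EventuallyEq.deriv_eq (f := fun _ => (0 : ℂ)) h]; simp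
    rw [h1, h.self_of_nhds]; simp
  · have hc1 : Tendsto (fun w => ‖deriv (deriv G) w‖) (𝓝[≠] z) (𝓝 ‖deriv (deriv G) z‖) :=
      han.deriv.continuousAt.norm.tendsto.mono_left nhdsWithin_le_nhds
    have hc2 : Tendsto (fun w => ε * ‖deriv G w‖) (𝓝[≠] z) (𝓝 (ε * ‖deriv G z‖)) :=
      (han.continuousAt.norm.tendsto.const_mul ε).mono_left nhdsWithin_le_nhds
    refine le_of_tendsto_of_tendsto hc1 hc2 ?_
    filter_upwards [h, mem_nhdsWithin_of_mem_nhds hnhds] with w h1 h2 using hoff w h2 h1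

theorem lineMap_mem_strip {z w : ℂ} (hz : z ∈ strip Δ) (hw : w ∈ strip Δ) {t : ℝ}
    (ht : t ∈ Icc (0 : ℝ) 1) : AffineMap.lineMap w z t ∈ strip Δ :=
  (convex_strip Δ).lineMap_mem hw hz ht

theorem hasDerivAt_deriv_lineMap (hG : NonlinearityBound g Δ ε G) {z w : ℂ} {t : ℝ}
    (ht : AffineMap.lineMap w z t ∈ strip Δ) :
    HasDerivAt (fun t : ℝ => deriv G (AffineMap.lineMap w z t))
      (deriv (deriv G) (AffineMap.lineMap w z t) * (z - w)) t := by
  have h1 := (hG.differentiableOn_deriv.differentiableAt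
    ((isOpen_strip Δ).mem_nhds ht)).hasDerivAt
  exact h1.comp_of_eq t (AffineMap.hasDerivAt_lineMap (a := w) (b := z) (x := t)) rfl

/-- A zero of `G'` would propagate to the real line along a segment, by Grönwall's inequality
applied to `|G''| ≤ ε |G'|`. -/
theorem deriv_ne_zero (hG : NonlinearityBound g Δ ε G) {z : ℂ} (hz : z ∈ strip Δ) :
    deriv G z ≠ 0 := by
  intro h0
  set w : ℂ := ((0 : ℝ) : ℂ)
  have hw : w ∈ strip Δ := ofReal_mem_strip hG.pos 0
  have hmem : ∀ t ∈ Icc (0 : ℝ) 1, AffineMap.lineMap z w t ∈ strip Δ :=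
    fun t ht => lineMap_mem_strip hw hz ht
  have h := norm_le_gronwallBound_of_norm_deriv_right_le
    (f := fun t : ℝ => deriv G (AffineMap.lineMap z w t)) (δ := 0) (K := ε * ‖w - z‖) (ε := 0)
    (fun t ht => (hG.hasDerivAt_deriv_lineMap (hmem t ht)).continuousAt.continuousWithinAt)
    (fun t ht => (hG.hasDerivAt_deriv_lineMap (hmem t ⟨ht.1, ht.2.le⟩)).hasDerivWithinAt)
    (by simp [h0]) (fun t ht => by
      rw [norm_mul, add_zero]
      have := hG.norm_deriv_deriv_le (hmem t ⟨ht.1, ht.2.le⟩)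
      calc _ ≤ (ε * ‖deriv G (AffineMap.lineMap z w t)‖) * ‖w - z‖ := by gcongr
        _ = _ := by ring) 1 ⟨zero_le_one, le_rfl⟩
  simp only [AffineMap.lineMap_apply_one, gronwallBound_ε0_δ0, norm_le_zero_iff] at h
  exact hG.deriv_real_ne_zero 0 h

/-- The logarithm of `G'` is `ε`-Lipschitz; stated without choosing a branch. -/
theorem exists_deriv_eq_mul_exp (hG : NonlinearityBound g Δ ε G) {z w : ℂ} (hz : z ∈ strip Δ)
    (hw : w ∈ strip Δ) :
    ∃ l : ℂ, ‖l‖ ≤ ε * ‖z - w‖ ∧ deriv G z = deriv G w * Complex.exp l := by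
  set γ : ℝ → ℂ := fun t => AffineMap.lineMap w z t with hγ
  have hmem : ∀ t ∈ Icc (0 : ℝ) 1, γ t ∈ strip Δ := fun t ht => lineMap_mem_strip hz hw ht
  have hγc : Continuous γ := by
    have : γ = fun t => AffineMap.lineMap w z t := rfl
    rw [this]; exact AffineMap.lineMap_continuous
  set q : ℝ → ℂ := fun t => logDeriv (deriv G) (γ t) * (z - w) with hq
  set V : Set ℝ := γ ⁻¹' strip Δ with hV
  have hVo : IsOpen V := (isOpen_strip Δ).preimage hγc
  have hld : ContinuousOn (logDeriv (deriv G)) (strip Δ) := by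
    have h2 := (hG.differentiableOn_deriv.deriv (isOpen_strip Δ)).continuousOn
    exact h2.div hG.differentiableOn_deriv.continuousOn fun y hy => hG.deriv_ne_zero hy
  have hqc : ContinuousOn q V :=
    (hld.comp hγc.continuousOn fun t ht => ht).mul continuousOn_const
  have hderiv : ∀ t ∈ Icc (0 : ℝ) 1, HasDerivAt (fun t => ∫ s in (0 : ℝ)..t, q s) (q t) t := by
    intro t ht
    have htV : t ∈ V := hmem t ht
    refine intervalIntegral.integral_hasDerivAt_right ?_
      (hqc.stronglyMeasurableAtFilter hVo t htV) (hqc.continuousAt (hVo.mem_nhds htV))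
    refine (hqc.mono fun s hs => ?_).intervalIntegrable
    rw [uIcc_of_le ht.1] at hs
    exact hmem s ⟨hs.1, hs.2.trans ht.2⟩
  have hprod : ∀ t ∈ Icc (0 : ℝ) 1, HasDerivAt
      (fun t => deriv G (γ t) * Complex.exp (-∫ s in (0 : ℝ)..t, q s)) 0 t := by
    intro t ht
    have h1 := (hG.hasDerivAt_deriv_lineMap (z := z) (w := w) (hmem t ht)).mul
      (hderiv t ht).neg.cexp
    refine h1.congr_deriv ?_
    have h0 := hG.deriv_ne_zero (hmem t ht)
    change _ * _ * Complex.exp _ + deriv G (γ t) * (Complex.exp _ * -(q t)) = 0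
    simp only [hq, logDeriv_apply]
    change deriv (deriv G) (γ t) * _ * _ + _ = _
    field_simp
    ring
  have hconst := constant_of_has_deriv_right_zero (a := (0 : ℝ)) (b := 1)
    (fun t ht => (hprod t ht).continuousAt.continuousWithinAt)
    (fun t ht => (hprod t ⟨ht.1, ht.2.le⟩).hasDerivWithinAt) 1 ⟨zero_le_one, le_rfl⟩
  refine ⟨∫ s in (0 : ℝ)..1, q s, ?_, ?_⟩
  · have := intervalIntegral.norm_integral_le_of_norm_le_const (a := (0 : ℝ)) (b := 1) (f := q)
      (C := ε * ‖z - w‖) (fun t ht => by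
        rw [uIoc_of_le zero_le_one] at ht
        rw [hq, norm_mul]
        exact mul_le_mul_of_nonneg_right (hG.norm_logDeriv_le _ (hmem t ⟨ht.1.le, ht.2⟩))
          (norm_nonneg _))
    simpa using this
  · simp only [hγ, AffineMap.lineMap_apply_one, AffineMap.lineMap_apply_zero,
      intervalIntegral.integral_same, neg_zero, Complex.exp_zero, mul_one] at hconst
    rw [← hconst, mul_assoc, ← Complex.exp_add]
    simp

theorem hasDerivAt_ofReal (hG : NonlinearityBound g Δ ε G) (x : ℝ) :
    HasDerivAt g (deriv G x).re x ∧ deriv G x = ((deriv G x).re : ℂ) := by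
  have h := (hG.differentiableOn.differentiableAt
    ((isOpen_strip Δ).mem_nhds (ofReal_mem_strip hG.pos x))).hasDerivAt
  have h1 : HasDerivAt g (deriv G x).re x := by
    have := h.real_of_complex
    simpa [hG.map_real] using this
  refine ⟨h1, ?_⟩
  have h2 := h.comp_ofReal
  simp only [hG.map_real] at h2
  exact h2.unique h1.ofReal_comp

theorem deriv_ofReal (hG : NonlinearityBound g Δ ε G) (x : ℝ) :
    deriv G x = ((deriv g x : ℝ) : ℂ) := by
  rw [(hG.hasDerivAt_ofReal x).1.deriv]
  exact (hG.hasDerivAt_ofReal x).2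

theorem hasDerivAt (hG : NonlinearityBound g Δ ε G) (x : ℝ) : HasDerivAt g (deriv g x) x :=
  (hG.hasDerivAt_ofReal x).1.differentiableAt.hasDerivAt

theorem deriv_pos (hG : NonlinearityBound g Δ ε G) (x : ℝ) : 0 < deriv g x := by
  refine lt_of_le_of_ne g.monotone.deriv_nonneg fun h => hG.deriv_real_ne_zero x ?_
  rw [hG.deriv_ofReal, ← h]
  simp

theorem strictMono (hG : NonlinearityBound g Δ ε G) : StrictMono g :=
  strictMono_of_deriv_pos hG.deriv_pos

theorem deriv_le_mul_exp (hG : NonlinearityBound g Δ ε G) (x y : ℝ) :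
    deriv g y ≤ deriv g x * Real.exp (ε * |y - x|) := by
  obtain ⟨l, hl, h⟩ := hG.exists_deriv_eq_mul_exp (ofReal_mem_strip hG.pos y)
    (ofReal_mem_strip hG.pos x)
  rw [hG.deriv_ofReal, hG.deriv_ofReal] at h
  have h1 := congrArg norm h
  rw [norm_mul, Complex.norm_real, Complex.norm_real, Real.norm_of_nonneg (hG.deriv_pos y).le,
    Real.norm_of_nonneg (hG.deriv_pos x).le] at h1
  rw [h1]
  have h2 : ‖((y : ℂ) - x)‖ = |y - x| := by
    rw [← Complex.ofReal_sub, Complex.norm_real, Real.norm_eq_abs]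
  rw [h2] at hl
  gcongr
  · exact (hG.deriv_pos x).le
  · exact (Complex.norm_exp_le_exp_norm l).trans (Real.exp_le_exp.2 hl)

end NonlinearityBound

/-- The derivative of `g^n` at `x`, as a product along the orbit. -/
noncomputable def orbitDeriv (g : CircleDeg1Lift) (n : ℕ) (x : ℝ) : ℝ :=
  ∏ i ∈ Finset.range n, deriv g (g^[i] x)

namespace NonlinearityBound

variable {g : CircleDeg1Lift} {Δ ε : ℝ} {G : ℂ → ℂ}

theorem orbitDeriv_pos (hG : NonlinearityBound g Δ ε G) (n : ℕ) (x : ℝ) : 0 < orbitDeriv g n x :=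
  Finset.prod_pos fun _ _ => hG.deriv_pos _

theorem hasDerivAt_iterate (hG : NonlinearityBound g Δ ε G) (n : ℕ) (x : ℝ) :
    HasDerivAt g^[n] (orbitDeriv g n x) x := by
  induction n with
  | zero => simpa [orbitDeriv] using hasDerivAt_id x
  | succ n ih =>
    rw [Function.iterate_succ', orbitDeriv, Finset.prod_range_succ, mul_comm]
    exact (hG.hasDerivAt _).comp x ih

/-- Denjoy's distortion estimate: the ratio of the derivatives of `g^n` at two points is controlled
by the total length of the arcs joining their orbits. -/
theorem orbitDeriv_le_mul_exp (hG : NonlinearityBound g Δ ε G) (n : ℕ) (x y : ℝ) :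
    orbitDeriv g n y ≤
      orbitDeriv g n x * Real.exp (ε * ∑ i ∈ Finset.range n, |g^[i] y - g^[i] x|) := by
  rw [orbitDeriv, orbitDeriv, Finset.mul_sum, Real.exp_sum, ← Finset.prod_mul_distrib]
  exact Finset.prod_le_prod (fun _ _ => (hG.deriv_pos _).le) fun _ _ => hG.deriv_le_mul_exp _ _

theorem exists_iterate_sub_eq (hG : NonlinearityBound g Δ ε G) (n : ℕ) {x y : ℝ} (hxy : x < y) :
    ∃ c ∈ Ioo x y, g^[n] y - g^[n] x = orbitDeriv g n c * (y - x) := by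
  obtain ⟨c, hc, h⟩ := exists_hasDerivAt_eq_slope g^[n] (orbitDeriv g n) hxy
    (fun t _ => (hG.hasDerivAt_iterate n t).continuousAt.continuousWithinAt)
    (fun t _ => hG.hasDerivAt_iterate n t)
  refine ⟨c, hc, ?_⟩
  rw [h, div_mul_cancel₀]
  linarith

end NonlinearityBound

/-! ### Denjoy's theorem -/

/-- `F` is a degree one semiconjugacy from `g` to the rotation by its translation number. -/
def IsSemilinearization (g F : CircleDeg1Lift) : Prop :=
  ∀ x, F (g x) = F x + g.translationNumber

theorem exists_isSemilinearization {g : CircleDeg1Lift} (hg : Function.Bijective g) :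
    ∃ F : CircleDeg1Lift, IsSemilinearization g F := by
  let T : CircleDeg1Liftˣ :=
    CircleDeg1Lift.translate (Multiplicative.ofAdd g.translationNumber)
  obtain ⟨F, hF⟩ := CircleDeg1Lift.semiconj_of_bijective_of_translationNumber_eq (f₁ := g)
    (f₂ := T) hg (CircleDeg1Lift.isUnit_iff_bijective.1 T.isUnit)
    (CircleDeg1Lift.translationNumber_translate _).symm
  refine ⟨F, fun x => ?_⟩
  rw [hF.eq, CircleDeg1Lift.translate_apply, add_comm]

namespace IsSemilinearization

variable {g F : CircleDeg1Lift}

theorem iterate (hF : IsSemilinearization g F) (n : ℕ) (x : ℝ) :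
    F (g^[n] x) = F x + n * g.translationNumber := by
  induction n with
  | zero => simp
  | succ n ih => rw [Function.iterate_succ_apply', hF, ih]; push_cast; ring

/-- The image of `F` is invariant under the dense group generated by `1` and the translation
number. -/
theorem continuous (hF : IsSemilinearization g F) (hg : Function.Surjective g)
    (hα : Irrational g.translationNumber) : Continuous F := by
  refine F.monotone.continuous_of_denseRange ?_
  set α := g.translationNumber
  have hdense : Dense (AddSubgroup.closure {α, (1 : ℝ)} : Set ℝ) := by
    rw [dense_addSubgroupClosure_pair_iff]; simpa using hα
  let S : AddSubgroup ℝ :=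
    { carrier := {s | ∀ y, y ∈ range F ↔ y + s ∈ range F}
      zero_mem' := by simp
      add_mem' := fun {a b} ha hb y => by rw [ha y, hb (y + a), add_assoc]
      neg_mem' := fun {a} ha y => by rw [ha (y + -a)]; simp }
  have hle : AddSubgroup.closure {α, (1 : ℝ)} ≤ S := by
    rw [AddSubgroup.closure_le]
    rintro s (rfl | rfl) y
    · constructor
      · rintro ⟨x, rfl⟩
        exact ⟨g x, hF x⟩
      · rintro ⟨x, hx⟩
        obtain ⟨z, rfl⟩ := hg x
        exact ⟨z, by rw [hF z] at hx; linarith⟩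
    · constructor
      · rintro ⟨x, rfl⟩
        exact ⟨x + 1, F.map_add_one x⟩
      · rintro ⟨x, hx⟩
        refine ⟨x - 1, ?_⟩
        have := F.map_add_one (x - 1)
        rw [sub_add_cancel] at this
        linarith
  have hsub : (fun s => F 0 + s) '' (AddSubgroup.closure {α, (1 : ℝ)} : Set ℝ) ⊆ range F := by
    rintro _ ⟨s, hs, rfl⟩
    exact (hle hs (F 0)).1 ⟨0, rfl⟩
  exact ((Homeomorph.addLeft (F 0)).surjective.denseRange.dense_image
    (Homeomorph.addLeft (F 0)).continuous hdense).mono hsub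

/-- If the images of `x < y` in the linear model are at distance at most `|q_n α - p_n|`, the first
`q_n` iterates of the arc between them are disjoint on the circle. -/
theorem sum_range_convDen_le_one (hF : IsSemilinearization g F) (hg : StrictMono g)
    (hα : Irrational g.translationNumber) {n : ℕ} {x y : ℝ} (hxy : x < y)
    (h : F y - F x ≤ |convErr g.translationNumber n|) :
    ∑ i ∈ Finset.range (convDen g.translationNumber n), (g^[i] y - g^[i] x) ≤ 1 := by
  refine sum_length_le_one _ (fun i => g^[i] x) (fun i => g^[i] y)
    (fun i _ => hg.iterate i hxy) fun i hi j hj k hne z h1 h2 h3 h4 => ?_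
  have e1 := F.monotone h1
  have e2 := F.monotone h2.le
  have e3 := F.monotone h3
  have e4 := F.monotone h4.le
  rw [F.map_add_int] at e3 e4
  rw [hF.iterate] at e1 e2 e3 e4
  have hs := abs_convErr_lt_sub hα n (k := k) (Finset.mem_range.1 hi) (Finset.mem_range.1 hj) hne
  refine hs.not_ge (le_trans (abs_le.2 ⟨?_, ?_⟩) h) <;> linarith

/-- For an injective semiconjugacy the same holds for the first `q_{n+1}` iterates. -/
theorem sum_range_convDen_succ_le_one (hF : IsSemilinearization g F) (hg : StrictMono g)
    (hFm : StrictMono F) (hα : Irrational g.translationNumber) {n : ℕ} {x y : ℝ} (hxy : x < y)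
    (h : F y - F x ≤ |convErr g.translationNumber n|) :
    ∑ i ∈ Finset.range (convDen g.translationNumber (n + 1)), (g^[i] y - g^[i] x) ≤ 1 := by
  refine sum_length_le_one _ (fun i => g^[i] x) (fun i => g^[i] y)
    (fun i _ => hg.iterate i hxy) fun i hi j hj k hne z h1 h2 h3 h4 => ?_
  have e1 := F.monotone h1
  have e2 := hFm h2
  have e3 := F.monotone h3
  have e4 := hFm h4
  rw [F.map_add_int] at e3 e4
  rw [hF.iterate] at e1 e2 e3 e4
  have hs := abs_convErr_le_sub hα n (k := k) (Finset.mem_range.1 hi) (Finset.mem_range.1 hj) hne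
  refine hs.not_gt (lt_of_lt_of_le (abs_lt.2 ⟨?_, ?_⟩) h) <;> linarith

/-- The iterates of an arc collapsed by `F` are disjoint, so their lengths tend to zero. -/
theorem tendsto_iterate_sub (hF : IsSemilinearization g F) (hg : StrictMono g)
    (hα : Irrational g.translationNumber) {a b : ℝ} (hab : a < b) (hFab : F a = F b) :
    Tendsto (fun i => g^[i] b - g^[i] a) atTop (𝓝 0) := by
  refine (summable_of_sum_le (c := 1) (fun i => sub_nonneg.2 (hg.iterate i hab).le) fun s =>
    sum_length_le_one s (fun i => g^[i] a) (fun i => g^[i] b)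
      (fun i _ => hg.iterate i hab) fun i _ j _ k hne z h1 h2 h3 h4 => ?_).tendsto_atTop_zero
  have e1 := F.monotone h1
  have e2 := F.monotone h2.le
  have e3 := F.monotone h3
  have e4 := F.monotone h4.le
  rw [F.map_add_int] at e3 e4
  rw [hF.iterate] at e1 e2 e3 e4
  have heq : ((i : ℝ) - j) * g.translationNumber = k := by linarith
  by_cases hij : i = j
  · subst hij
    have : (k : ℝ) = 0 := by rw [← heq]; ring
    exact hne.elim (fun h => h rfl) fun h => h (by exact_mod_cast this)
  · have h0 : ((i : ℝ) - j) ≠ 0 := sub_ne_zero.2 (by exact_mod_cast hij)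
    exact hα ⟨(k : ℚ) / ((i : ℚ) - j), by push_cast; rw [div_eq_iff h0]; linarith⟩

/-- Denjoy's theorem. A collapsed arc `I` would have `|g^{q_n} I| |g^{-q_n} I| ≥ e^{-ε} |I|²` by the
distortion estimate along the disjoint arcs joining `g^i I` and `g^{i - q_n} I`, while
`|g^{q_n} I|` tends to zero and `|g^{-q_n} I| ≤ 1`. -/
theorem strictMono {Δ ε : ℝ} {G : ℂ → ℂ} (hF : IsSemilinearization g F)
    (hG : NonlinearityBound g Δ ε G) (hsurj : Function.Surjective g)
    (hα : Irrational g.translationNumber) : StrictMono F := by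
  refine F.monotone.strictMono_of_injective fun a b hFab => ?_
  by_contra hne
  wlog hab : a < b generalizing a b
  · exact this b a hFab.symm (Ne.symm hne) (lt_of_le_of_ne (not_lt.1 hab) (Ne.symm hne))
  have hg := hG.strictMono
  have hconst : ∀ {a b : ℝ}, F a = F b → ∀ c ∈ Ioo a b, F c = F a := fun h c hc =>
    le_antisymm ((F.monotone hc.2.le).trans h.ge) (F.monotone hc.1.le)
  have hq : Tendsto (fun n => convDen g.translationNumber (n + 1)) atTop atTop :=
    tendsto_atTop_mono (fun n => (lt_convDen_succ hα n).le) tendsto_id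
  have hpos : 0 < (b - a) ^ 2 * Real.exp (-ε) := by
    have : 0 < b - a := sub_pos.2 hab
    positivity
  obtain ⟨m, hm⟩ := (((hF.tendsto_iterate_sub hg hα hab hFab).comp hq).eventually
    (gt_mem_nhds hpos)).exists
  simp only [Function.comp_apply] at hm
  set n := m + 1
  set α := g.translationNumber
  set q := convDen α n
  set p := convNum α n
  obtain ⟨a', ha'⟩ := hsurj.iterate q (a + p)
  obtain ⟨b', hb'⟩ := hsurj.iterate q (b + p)
  have hab' : a' < b' := by
    rw [← (hg.iterate q).lt_iff_lt, ha', hb']; linarith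
  have hFa' : F a' = F a - convErr α n := by
    have := hF.iterate q a'
    rw [ha', F.map_add_int] at this
    rw [convErr]; linarith
  have hFb' : F b' = F a - convErr α n := by
    have := hF.iterate q b'
    rw [hb', F.map_add_int, ← hFab] at this
    rw [convErr]; linarith
  have hlen : b' - a' ≤ 1 := by
    by_contra! h
    have := F.monotone (show a' + 1 ≤ b' by linarith)
    rw [F.map_add_one, hFa', hFb'] at this
    linarith
  obtain ⟨c, hc, hcd⟩ := hG.exists_iterate_sub_eq q hab
  obtain ⟨c', hc', hcd'⟩ := hG.exists_iterate_sub_eq q hab'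
  have hFc := hconst hFab c hc
  have hFc' := hconst (hFa'.trans hFb'.symm) c' hc'
  have hsum : ∑ i ∈ Finset.range q, |g^[i] c' - g^[i] c| ≤ 1 := by
    rcases lt_trichotomy c c' with h | h | h
    · have hs := hF.sum_range_convDen_le_one hg hα (n := n) h
        (by rw [hFc, hFc', hFa']; have := neg_le_abs (convErr α n); linarith)
      refine le_of_eq_of_le (Finset.sum_congr rfl fun i _ => ?_) hs
      exact abs_of_pos (sub_pos.2 (hg.iterate i h))
    · simp [h]
    · have hs := hF.sum_range_convDen_le_one hg hα (n := n) h
        (by rw [hFc, hFc', hFa']; have := le_abs_self (convErr α n); linarith)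
      refine le_of_eq_of_le (Finset.sum_congr rfl fun i _ => ?_) hs
      rw [abs_sub_comm]
      exact abs_of_pos (sub_pos.2 (hg.iterate i h))
  have hD : orbitDeriv g q c' ≤ orbitDeriv g q c * Real.exp ε := by
    refine (hG.orbitDeriv_le_mul_exp q c c').trans ?_
    have h0 := hG.orbitDeriv_pos q c
    gcongr
    exact mul_le_of_le_one_right hG.nonneg hsum
  rw [ha', hb'] at hcd'
  have h1 : b - a ≤ orbitDeriv g q c * Real.exp ε := by
    calc b - a = orbitDeriv g q c' * (b' - a') := by linarith
      _ ≤ orbitDeriv g q c' := mul_le_of_le_one_right (hG.orbitDeriv_pos q c').le hlen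
      _ ≤ _ := hD
  have h2 : (b - a) ^ 2 * Real.exp (-ε) ≤ g^[q] b - g^[q] a := by
    rw [hcd, Real.exp_neg, ← div_eq_mul_inv, div_le_iff₀ (Real.exp_pos ε)]
    nlinarith
  exact hm.not_ge h2

end IsSemilinearization

theorem NonlinearityBound.exists_isLinearization {g : CircleDeg1Lift} {Δ ε : ℝ} {G : ℂ → ℂ}
    (hG : NonlinearityBound g Δ ε G) (hsurj : Function.Surjective g)
    (hα : Irrational g.translationNumber) : ∃ h : ℝ ≃o ℝ, IsLinearization g h := by
  obtain ⟨F, hF⟩ := exists_isSemilinearization ⟨hG.strictMono.injective, hsurj⟩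
  have hFs : Function.Surjective F := F.continuous_iff_surjective.1 (hF.continuous hsurj hα)
  let H : ℝ ≃o ℝ := StrictMono.orderIsoOfSurjective F (hF.strictMono hG hsurj hα) hFs
  have hH : ∀ x, H x = F x := fun _ => rfl
  refine ⟨H.symm, fun x => ?_, fun x => ?_⟩
  · rw [OrderIso.symm_apply_eq, hH, F.map_add_one, ← hH, H.apply_symm_apply]
  · rw [OrderIso.symm_symm, hH, hF, ← hH, H.apply_symm_apply]

/-! ### Displacements of closest returns -/

theorem uniformContinuous_of_continuous_circleDeg1Lift {f : CircleDeg1Lift} (hf : Continuous f) :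
    UniformContinuous f := by
  refine Metric.uniformContinuous_iff.2 fun δ hδ => ?_
  obtain ⟨η, hη, hmod⟩ := Metric.uniformContinuousOn_iff.1
    (isCompact_Icc (a := (-1 : ℝ)) (b := 2) |>.uniformContinuousOn_of_continuous hf.continuousOn)
    δ hδ
  refine ⟨min η 1, by positivity, fun {s t} hst => ?_⟩
  -- Reduce to a compact interval by an integer translation.
  have h1 := Int.floor_le s
  have h2 := Int.lt_floor_add_one s
  have h3 := abs_lt.1 (hst.trans_le (min_le_right _ _))
  have := hmod (s - ⌊s⌋) ⟨by linarith, by linarith⟩ (t - ⌊s⌋) ⟨by linarith, by linarith⟩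
    (by rw [dist_sub_right]; exact hst.trans_le (min_le_left _ _))
  rwa [f.map_sub_int, f.map_sub_int, dist_sub_right] at this

/-- The inverse of a linearization, as a degree one map. -/
def IsLinearization.inv {g : CircleDeg1Lift} {h : ℝ ≃o ℝ} (hh : IsLinearization g h) :
    CircleDeg1Lift where
  toFun := h.symm
  monotone' := h.symm.monotone
  map_add_one' x := by rw [OrderIso.symm_apply_eq, hh.1, h.apply_symm_apply]

namespace IsLinearization

variable {g : CircleDeg1Lift} {h : ℝ ≃o ℝ}

theorem inv_apply (hh : IsLinearization g h) (x : ℝ) : hh.inv x = h.symm x := rfl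

theorem isSemilinearization_inv (hh : IsLinearization g h) : IsSemilinearization g hh.inv := by
  intro x
  have := hh.2 (h.symm x)
  rwa [h.apply_symm_apply] at this

theorem strictMono_inv (hh : IsLinearization g h) : StrictMono hh.inv := h.symm.strictMono

theorem realFlow_natCast (hh : IsLinearization g h) (j : ℕ) (x : ℝ) :
    realFlow g h j x = g^[j] x := by
  rw [realFlow, ← OrderIso.eq_symm_apply]
  exact (hh.isSemilinearization_inv.iterate j x).symm

theorem symm_add_displacement (hh : IsLinearization g h) (n : ℕ) (x : ℝ) :
    h.symm (x + displacement g n x) = h.symm x + convErr g.translationNumber n := by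
  have h1 : x + displacement g n x =
      g^[convDen g.translationNumber n] x - convNum g.translationNumber n := by
    rw [displacement]; ring
  rw [h1, ← hh.inv_apply, hh.inv.map_sub_int, hh.isSemilinearization_inv.iterate, convErr,
    hh.inv_apply]
  ring

theorem displacement_ne_zero (hh : IsLinearization g h) (hα : Irrational g.translationNumber)
    (n : ℕ) (x : ℝ) : displacement g n x ≠ 0 := by
  intro h0
  have := hh.symm_add_displacement n x
  rw [h0, add_zero] at this
  exact convErr_ne_zero hα n (by linarith)

/-- `g^i` maps the closest return arc at `x` to the closest return arc at `g^i x`. -/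
theorem iterate_add_displacement (n i : ℕ) (x : ℝ) :
    g^[i] (x + displacement g n x) = g^[i] x + displacement g n (g^[i] x) := by
  have h1 : x + displacement g n x =
      g^[convDen g.translationNumber n] x - convNum g.translationNumber n := by
    rw [displacement]; ring
  have h2 : ∀ y (k : ℤ), g^[i] (y - k) = g^[i] y - k := fun y k => by
    rw [← CircleDeg1Lift.coe_pow]; exact (g ^ i).map_sub_int y k
  rw [h1, h2, displacement, ← Function.iterate_add_apply, add_comm i, Function.iterate_add_apply]
  ring

/-- The closest return arcs `g^i [x, x + m_n(x)]`, `i < q_{n+1}`, are disjoint on the circle. -/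
theorem sum_abs_displacement_le_one (hh : IsLinearization g h) (hg : StrictMono g)
    (hα : Irrational g.translationNumber) (n : ℕ) (x : ℝ) :
    ∑ i ∈ Finset.range (convDen g.translationNumber (n + 1)), |displacement g n (g^[i] x)| ≤ 1 := by
  have hd : ∀ i, displacement g n (g^[i] x) = g^[i] (x + displacement g n x) - g^[i] x :=
    fun i => by rw [iterate_add_displacement]; ring
  simp only [hd]
  have hF := hh.symm_add_displacement n x
  rw [← hh.inv_apply, ← hh.inv_apply] at hF
  rcases lt_or_gt_of_ne (hh.displacement_ne_zero hα n x) with h0 | h0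
  · have hlt : x + displacement g n x < x := by linarith
    refine le_of_eq_of_le (Finset.sum_congr rfl fun i _ => ?_)
      (hh.isSemilinearization_inv.sum_range_convDen_succ_le_one hg hh.strictMono_inv hα (n := n)
        hlt (by have := neg_le_abs (convErr g.translationNumber n); linarith))
    rw [abs_sub_comm]
    exact abs_of_pos (sub_pos.2 (hg.iterate i hlt))
  · have hlt : x < x + displacement g n x := by linarith
    refine le_of_eq_of_le (Finset.sum_congr rfl fun i _ => ?_)
      (hh.isSemilinearization_inv.sum_range_convDen_succ_le_one hg hh.strictMono_inv hα (n := n)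
        hlt (by have := le_abs_self (convErr g.translationNumber n); linarith))
    exact abs_of_pos (sub_pos.2 (hg.iterate i hlt))

theorem exists_forall_abs_displacement_lt (hh : IsLinearization g h)
    (hα : Irrational g.translationNumber) {δ : ℝ} (hδ : 0 < δ) :
    ∃ n₀ : ℕ, 1 ≤ n₀ ∧ ∀ n, n₀ < n → ∀ x, |displacement g n x| < δ := by
  have huc : UniformContinuous h :=
    uniformContinuous_of_continuous_circleDeg1Lift
      (f := ⟨⟨h, h.monotone⟩, hh.1⟩) h.continuous
  obtain ⟨η, hη, hmod⟩ := Metric.uniformContinuous_iff.1 huc δ hδ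
  obtain ⟨N, hN⟩ := exists_nat_one_div_lt hη
  refine ⟨N + 1, by omega, fun n hn x => ?_⟩
  have herr : |convErr g.translationNumber n| < η := by
    refine (abs_convErr_le hα n).trans_lt (lt_of_le_of_lt ?_ hN)
    have := lt_convDen_succ hα n
    gcongr
    exact_mod_cast (by omega : N + 1 ≤ convDen g.translationNumber (n + 1))
  have h1 := hh.symm_add_displacement n x
  have h2 := hmod (a := h.symm (x + displacement g n x)) (b := h.symm x)
    (by rw [h1, Real.dist_eq]; simpa using herr)
  simpa [Real.dist_eq] using h2

end IsLinearization

/-! ### Distortion of vertical segments -/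

namespace NonlinearityBound

variable {g : CircleDeg1Lift} {Δ ε : ℝ} {G : ℂ → ℂ} {h : ℝ ≃o ℝ}

/-- The mean value theorem for `g^j` on the closest return arc at `x`; the orbit of the intermediate
point `c` stays in the iterates of that arc. -/
theorem exists_abs_displacement_iterate_eq (hG : NonlinearityBound g Δ ε G)
    (hh : IsLinearization g h) (hα : Irrational g.translationNumber) (n j : ℕ) (x : ℝ) :
    ∃ c, |displacement g n (g^[j] x)| = orbitDeriv g j c * |displacement g n x| ∧
      ∀ i, |g^[i] c - g^[i] x| ≤ |displacement g n (g^[i] x)| := by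
  have hd : ∀ i, displacement g n (g^[i] x) = g^[i] (x + displacement g n x) - g^[i] x :=
    fun i => by rw [IsLinearization.iterate_add_displacement]; ring
  simp only [hd]
  have hm : ∀ i, Monotone g^[i] := fun i => g.monotone.iterate i
  rcases lt_or_gt_of_ne (hh.displacement_ne_zero hα n x) with h0 | h0
  · obtain ⟨c, hc, he⟩ :=
      hG.exists_iterate_sub_eq j (show x + displacement g n x < x by linarith)
    refine ⟨c, ?_, fun i => ?_⟩
    · rw [abs_sub_comm, he, abs_mul, abs_of_pos (hG.orbitDeriv_pos j c),
        show x - (x + displacement g n x) = -displacement g n x by ring, abs_neg]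
    · have h1 := hm i hc.1.le
      have h2 := hm i hc.2.le
      rw [abs_of_nonpos (by linarith), abs_of_nonpos (by linarith)]
      linarith
  · obtain ⟨c, hc, he⟩ :=
      hG.exists_iterate_sub_eq j (show x < x + displacement g n x by linarith)
    refine ⟨c, ?_, fun i => ?_⟩
    · rw [he, abs_mul, abs_of_pos (hG.orbitDeriv_pos j c), add_sub_cancel_left]
    · have h1 := hm i hc.1.le
      have h2 := hm i hc.2.le
      rw [abs_of_nonneg (by linarith), abs_of_nonneg (by linarith)]
      linarith

/-- Up to the next closest return time, the lengths of the closest return arcs are transported by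
the derivative along the orbit, up to a factor `e^ε`. -/
theorem abs_displacement_iterate_comparison (hG : NonlinearityBound g Δ ε G)
    (hh : IsLinearization g h) (hα : Irrational g.translationNumber) {n j : ℕ}
    (hj : j ≤ convDen g.translationNumber (n + 1)) (x : ℝ) :
    |displacement g n (g^[j] x)| ≤ Real.exp ε * (orbitDeriv g j x * |displacement g n x|) ∧
      orbitDeriv g j x * |displacement g n x| ≤ Real.exp ε * |displacement g n (g^[j] x)| := by
  obtain ⟨c, hc, hci⟩ := hG.exists_abs_displacement_iterate_eq hh hα n j x
  have hsum : ∑ i ∈ Finset.range j, |g^[i] c - g^[i] x| ≤ 1 :=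
    calc _ ≤ ∑ i ∈ Finset.range j, |displacement g n (g^[i] x)| :=
          Finset.sum_le_sum fun i _ => hci i
      _ ≤ ∑ i ∈ Finset.range (convDen g.translationNumber (n + 1)),
            |displacement g n (g^[i] x)| :=
          Finset.sum_le_sum_of_subset_of_nonneg (Finset.range_mono hj)
            fun _ _ _ => abs_nonneg _
      _ ≤ 1 := hh.sum_abs_displacement_le_one hG.strictMono hα n x
  have hε := hG.nonneg
  have hexp : Real.exp (ε * ∑ i ∈ Finset.range j, |g^[i] c - g^[i] x|) ≤ Real.exp ε :=
    Real.exp_le_exp.2 (mul_le_of_le_one_right hε hsum)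
  have h1 := hG.orbitDeriv_le_mul_exp j x c
  have h2 := hG.orbitDeriv_le_mul_exp j c x
  simp only [abs_sub_comm (g^[_] x)] at h2
  have p1 := hG.orbitDeriv_pos j x
  have p2 := hG.orbitDeriv_pos j c
  have p3 := abs_nonneg (displacement g n x)
  have h1' : orbitDeriv g j c ≤ Real.exp ε * orbitDeriv g j x := by
    rw [mul_comm]; exact h1.trans (by gcongr)
  have h2' : orbitDeriv g j x ≤ Real.exp ε * orbitDeriv g j c := by
    rw [mul_comm]; exact h2.trans (by gcongr)
  rw [hc, ← mul_assoc, ← mul_assoc]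
  exact ⟨by gcongr, by gcongr⟩

theorem iterate_ofReal (hG : NonlinearityBound g Δ ε G) (j : ℕ) (x : ℝ) :
    G^[j] (x : ℂ) = (g^[j] x : ℝ) := by
  induction j with
  | zero => rfl
  | succ j ih => rw [Function.iterate_succ_apply', ih, hG.map_real, Function.iterate_succ_apply']

end NonlinearityBound

/-- The vertical segment of height `S` above the real point `x`. -/
def verticalSegment (x S : ℝ) : Set ℂ := {x} ×ℂ Icc 0 S

theorem convex_verticalSegment (x S : ℝ) : Convex ℝ (verticalSegment x S) :=
  ((convex_singleton x).is_linear_preimage Complex.reLm.isLinear).inter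
    ((convex_Icc 0 S).is_linear_preimage Complex.imLm.isLinear)

theorem ofReal_mem_verticalSegment {x S : ℝ} (hS : 0 ≤ S) : (x : ℂ) ∈ verticalSegment x S := by
  simp [verticalSegment, Complex.mem_reProdIm, hS]

theorem norm_sub_of_mem_verticalSegment {x S : ℝ} {w : ℂ} (hw : w ∈ verticalSegment x S) :
    ‖w - x‖ = w.im := by
  obtain ⟨h1, h2⟩ := Complex.mem_reProdIm.1 hw
  have : w - x = (w.im : ℂ) * Complex.I := by
    apply Complex.ext <;> simp [mem_singleton_iff.1 h1]
  rw [this, norm_mul, Complex.norm_I, mul_one, Complex.norm_real, Real.norm_of_nonneg h2.1]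

/-- The factor `8 / 5` absorbs an oscillation `2 / 5` of the logarithmic derivative together with
the comparison factor `e^ε` for `ε = 1 / 32`. -/
theorem exp_two_fifths_mul_exp_le : Real.exp (2 / 5) * Real.exp (1 / 32) ≤ 8 / 5 := by
  rw [← Real.exp_add]
  have h1 : Real.exp (2 / 5 + 1 / 32) ^ 16 ≤ (8 / 5) ^ 16 := by
    rw [← Real.exp_nat_mul]
    calc Real.exp ((16 : ℕ) * (2 / 5 + 1 / 32)) ≤ Real.exp ((7 : ℕ) * 1) :=
          Real.exp_le_exp.2 (by norm_num)
      _ = Real.exp 1 ^ 7 := Real.exp_nat_mul 1 7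
      _ ≤ 2.7182818286 ^ 7 := by
          have := Real.exp_one_lt_d9
          gcongr
      _ ≤ (8 / 5) ^ 16 := by norm_num
  exact le_of_pow_le_pow_left₀ (by norm_num) (by norm_num) h1

namespace NonlinearityBound

variable {g : CircleDeg1Lift} {Δ ε : ℝ} {G : ℂ → ℂ} {h : ℝ ≃o ℝ}

/-- If the logarithm of the derivative of `G^j` oscillates by at most `2 / 5` on a vertical segment
of height `D |m_n(x)|`, the image of that segment stays at distance `8 D |m_n(g^j x)| / 5` from
`g^j x`. -/
theorem norm_iterate_sub_le (hG : NonlinearityBound g Δ ε G)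
    (hh : IsLinearization g h) (hα : Irrational g.translationNumber) (hε : ε ≤ 1 / 32)
    {n j : ℕ} (hj : j ≤ convDen g.translationNumber (n + 1)) {x D : ℝ} (hD : 0 ≤ D)
    (hder : ∀ w ∈ verticalSegment x (|displacement g n x| * D), ∃ l : ℂ, ‖l‖ ≤ 2 / 5 ∧
      HasDerivAt G^[j] (orbitDeriv g j x * Complex.exp l) w)
    {w : ℂ} (hw : w ∈ verticalSegment x (|displacement g n x| * D)) :
    ‖G^[j] w - (g^[j] x : ℝ)‖ ≤ 8 / 5 * D * |displacement g n (g^[j] x)| := by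
  choose! l hl hd using hder
  have hS : 0 ≤ |displacement g n x| * D := by positivity
  have hpos := hG.orbitDeriv_pos j x
  have hmv := (convex_verticalSegment x
    (|displacement g n x| * D)).norm_image_sub_le_of_norm_hasDerivWithin_le (C := orbitDeriv g j x * Real.exp (2 / 5)) (fun w hw => (hd w hw).hasDerivWithinAt)
    (fun w hw => by
      rw [norm_mul, Complex.norm_real, Real.norm_of_nonneg hpos.le]
      gcongr
      exact (Complex.norm_exp_le_exp_norm _).trans (Real.exp_le_exp.2 (hl w hw)))
    (ofReal_mem_verticalSegment hS) hw
  rw [hG.iterate_ofReal, norm_sub_of_mem_verticalSegment hw] at hmv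
  have him : w.im ≤ |displacement g n x| * D := (Complex.mem_reProdIm.1 hw).2.2
  have hcmp := (hG.abs_displacement_iterate_comparison hh hα hj x).2
  have hexp : Real.exp ε ≤ Real.exp (1 / 32) := Real.exp_le_exp.2 hε
  calc _ ≤ orbitDeriv g j x * Real.exp (2 / 5) * w.im := hmv
    _ ≤ orbitDeriv g j x * Real.exp (2 / 5) * (|displacement g n x| * D) := by gcongr
    _ = Real.exp (2 / 5) * D * (orbitDeriv g j x * |displacement g n x|) := by ring
    _ ≤ Real.exp (2 / 5) * D * (Real.exp (1 / 32) * |displacement g n (g^[j] x)|) := by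
        have := hcmp.trans (mul_le_mul_of_nonneg_right hexp (abs_nonneg _))
        gcongr
    _ = Real.exp (2 / 5) * Real.exp (1 / 32) * (D * |displacement g n (g^[j] x)|) := by ring
    _ ≤ 8 / 5 * (D * |displacement g n (g^[j] x)|) := by
        gcongr
        exact exp_two_fifths_mul_exp_le
    _ = _ := by ring

/-- The complex Denjoy estimate. On a vertical segment of height `D |m_n(x)|` with `ε D ≤ 1 / 4` the
iterates of `G` up to time `q_{n+1}` stay in the strip and the logarithms of their derivatives
oscillate by at most `2 / 5`. The bound closes up by induction on `j`: oscillation at most `2 / 5`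
up to time `j` keeps the orbit within `8 D |m_n(g^j x)| / 5` of the real line, so that the total
oscillation is at most `(8 / 5) ε D ∑ |m_n(g^i x)| ≤ 2 / 5`. -/
theorem iterate_verticalSegment (hG : NonlinearityBound g Δ ε G)
    (hh : IsLinearization g h) (hα : Irrational g.translationNumber) (hε : ε ≤ 1 / 32)
    {D : ℝ} (hD : 0 ≤ D) (hεD : ε * D ≤ 1 / 4) {n : ℕ}
    (hn : ∀ y, 8 / 5 * D * |displacement g n y| < Δ) (x : ℝ) {j : ℕ}
    (hj : j ≤ convDen g.translationNumber (n + 1)) :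
    ∀ w ∈ verticalSegment x (|displacement g n x| * D), (∀ i < j, G^[i] w ∈ strip Δ) ∧
      ∃ l : ℂ, ‖l‖ ≤ 2 / 5 ∧ HasDerivAt G^[j] (orbitDeriv g j x * Complex.exp l) w := by
  have hε0 := hG.nonneg
  have hsum : ∀ j ≤ convDen g.translationNumber (n + 1),
      8 / 5 * (ε * D) * ∑ i ∈ Finset.range j, |displacement g n (g^[i] x)| ≤ 2 / 5 := by
    intro j hj
    have h1 : ∑ i ∈ Finset.range j, |displacement g n (g^[i] x)| ≤ 1 :=
      (Finset.sum_le_sum_of_subset_of_nonneg (Finset.range_mono hj)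
        fun _ _ _ => abs_nonneg _).trans
        (hh.sum_abs_displacement_le_one hG.strictMono hα n x)
    calc _ ≤ 8 / 5 * (ε * D) * 1 := by gcongr
      _ ≤ 2 / 5 := by linarith
  suffices H : ∀ j ≤ convDen g.translationNumber (n + 1),
      ∀ w ∈ verticalSegment x (|displacement g n x| * D), (∀ i < j, G^[i] w ∈ strip Δ) ∧
        ∃ l : ℂ, ‖l‖ ≤ 8 / 5 * (ε * D) * ∑ i ∈ Finset.range j, |displacement g n (g^[i] x)| ∧
          HasDerivAt G^[j] (orbitDeriv g j x * Complex.exp l) w by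
    intro w hw
    obtain ⟨h1, l, hl, h2⟩ := H j hj w hw
    exact ⟨h1, l, hl.trans (hsum j hj), h2⟩
  intro j
  induction j with
  | zero =>
    intro _ w _
    refine ⟨fun i hi => absurd hi (Nat.not_lt_zero i), 0, by simp, ?_⟩
    simpa [orbitDeriv] using hasDerivAt_id w
  | succ j ih =>
    intro hj w hw
    have hj' : j ≤ convDen g.translationNumber (n + 1) := by omega
    obtain ⟨hstrip, l, hl, hder⟩ := ih hj' w hw
    have hclose := hG.norm_iterate_sub_le hh hα hε hj' hD (fun w hw => by
      obtain ⟨-, l, hl, h⟩ := ih hj' w hw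
      exact ⟨l, hl.trans (hsum j hj'), h⟩) hw
    have hmem : G^[j] w ∈ strip Δ := by
      have h1 := Complex.abs_im_le_norm (G^[j] w - (g^[j] x : ℝ))
      rw [Complex.sub_im, Complex.ofReal_im, sub_zero] at h1
      exact (h1.trans hclose).trans_lt (hn _)
    obtain ⟨l', hl', he⟩ := hG.exists_deriv_eq_mul_exp hmem
      (ofReal_mem_strip hG.pos (g^[j] x))
    refine ⟨fun i hi => ?_, l + l', ?_, ?_⟩
    · rcases Nat.lt_succ_iff_lt_or_eq.1 hi with h1 | rfl
      · exact hstrip i h1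
      · exact hmem
    · rw [Finset.sum_range_succ, mul_add]
      refine (norm_add_le _ _).trans (add_le_add hl (hl'.trans ?_))
      calc _ ≤ ε * (8 / 5 * D * |displacement g n (g^[j] x)|) := by gcongr
        _ = _ := by ring
    · have h1 := (hG.differentiableOn.differentiableAt
        ((isOpen_strip Δ).mem_nhds hmem)).hasDerivAt
      rw [Function.iterate_succ']
      refine (h1.comp w hder).congr_deriv ?_
      rw [he, hG.deriv_ofReal, orbitDeriv, orbitDeriv, Finset.prod_range_succ, Complex.exp_add]
      push_cast
      ring

/-- The image of a point `x + i s` of the vertical segment is `g^j x + i s (g^j)'(x)` up to a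
relative error `14 / 25` in the height. -/
theorem norm_iterate_sub_affine_le (hG : NonlinearityBound g Δ ε G) {j : ℕ} {x S : ℝ}
    (hder : ∀ w ∈ verticalSegment x S, ∃ l : ℂ, ‖l‖ ≤ 2 / 5 ∧
      HasDerivAt G^[j] (orbitDeriv g j x * Complex.exp l) w)
    {s : ℝ} (hs0 : 0 ≤ s) (hs : s ≤ S) :
    ‖G^[j] ⟨x, s⟩ - ⟨g^[j] x, orbitDeriv g j x * s⟩‖ ≤ 14 / 25 * (orbitDeriv g j x * s) := by
  choose! l hl hd using hder
  have hpos := hG.orbitDeriv_pos j x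
  have hw : (⟨x, s⟩ : ℂ) ∈ verticalSegment x S := Complex.mem_reProdIm.2 ⟨rfl, hs0, hs⟩
  have hmv := (convex_verticalSegment x S).norm_image_sub_le_of_norm_hasDerivWithin_le
    (C := 14 / 25 * orbitDeriv g j x)
    (fun w hw => ((hd w hw).sub
      ((hasDerivAt_id w).const_mul (orbitDeriv g j x : ℂ))).hasDerivWithinAt)
    (fun w hw => by
      have h1 := Complex.norm_exp_sub_one_sub_id_le (x := l w) ((hl w hw).trans (by norm_num))
      have h2 : ‖Complex.exp (l w) - 1‖ ≤ 14 / 25 := by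
        have h3 := norm_add_le (Complex.exp (l w) - 1 - l w) (l w)
        rw [sub_add_cancel] at h3
        have h4 := hl w hw
        nlinarith [norm_nonneg (l w)]
      rw [← mul_sub, norm_mul, Complex.norm_real, Real.norm_of_nonneg hpos.le, mul_comm]
      gcongr)
    (ofReal_mem_verticalSegment (hs0.trans hs)) hw
  rw [norm_sub_of_mem_verticalSegment hw] at hmv
  simp only [Pi.sub_apply, id, hG.iterate_ofReal] at hmv
  have he : G^[j] ⟨x, s⟩ - ⟨g^[j] x, orbitDeriv g j x * s⟩ =
      G^[j] ⟨x, s⟩ - orbitDeriv g j x * ⟨x, s⟩ - ((g^[j] x : ℝ) - orbitDeriv g j x * x) := by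
    apply Complex.ext
    · simp
    · simp
  rw [he]
  exact hmv.trans_eq (by ring)

end NonlinearityBound

/-- A point within `14 T / 25` of `X + i T` is at hyperbolic distance at most one from `X + i Y` for
`Y` comparable to `T`: the Euclidean distance is at most `3 T / 5` and
the product of the heights is at least `(11 / 25) (31 / 32) T²`. -/
theorem dist_upperHalfPlane_le_one {T X Y : ℝ} {z : ℂ} (hT : 0 < T)
    (hz : ‖z - ⟨X, T⟩‖ ≤ 14 / 25 * T) (hY1 : Y ≤ Real.exp (1 / 32) * T)
    (hY2 : T ≤ Real.exp (1 / 32) * Y) :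
    ∃ (h1 : 0 < z.im) (h2 : 0 < (⟨X, Y⟩ : ℂ).im),
      dist (⟨z, h1⟩ : UpperHalfPlane) ⟨⟨X, Y⟩, h2⟩ ≤ 1 := by
  have hexp : Real.exp (1 / 32) ≤ 32 / 31 := by
    have h := Real.add_one_le_exp (-(1 / 32 : ℝ))
    rw [Real.exp_neg] at h
    rw [← inv_inv (Real.exp (1 / 32))]
    exact (inv_anti₀ (by norm_num) h).trans_eq (by norm_num)
  have hY0 : 0 < Y := pos_of_mul_pos_right (hT.trans_le hY2) (Real.exp_pos _).le
  have hY3 : Y ≤ 32 / 31 * T := hY1.trans (by gcongr)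
  have hY4 : T ≤ 32 / 31 * Y := hY2.trans (by gcongr)
  have him : 11 / 25 * T ≤ z.im := by
    have h := (Complex.abs_im_le_norm _).trans hz
    rw [Complex.sub_im] at h
    have := (abs_le.1 h).1
    simp only at this
    linarith
  have hz0 : 0 < z.im := by linarith
  refine ⟨hz0, hY0, ?_⟩
  refine (UpperHalfPlane.dist_le_dist_coe_div_sqrt _ _).trans ?_
  refine div_le_one_of_le₀ (Real.le_sqrt_of_sq_le ?_) (Real.sqrt_nonneg _)
  have hd : dist z ⟨X, Y⟩ ≤ 3 / 5 * T := by
    rw [dist_eq_norm]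
    have h1 : ‖(⟨X, T⟩ : ℂ) - ⟨X, Y⟩‖ ≤ T / 31 := by
      have h2 : (⟨X, T⟩ : ℂ) - ⟨X, Y⟩ = ((T - Y : ℝ) : ℂ) * Complex.I := by
        apply Complex.ext <;> simp
      rw [h2, norm_mul, Complex.norm_I, mul_one, Complex.norm_real, Real.norm_eq_abs, abs_le]
      constructor <;> linarith
    have h3 := norm_add_le (z - ⟨X, T⟩) ((⟨X, T⟩ : ℂ) - ⟨X, Y⟩)
    rw [sub_add_sub_cancel] at h3
    linarith
  change dist z ⟨X, Y⟩ ^ 2 ≤ z.im * Y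
  calc dist z ⟨X, Y⟩ ^ 2 ≤ (3 / 5 * T) ^ 2 := by gcongr
    _ ≤ (11 / 25 * T) * (31 / 32 * T) := by nlinarith
    _ ≤ z.im * Y := mul_le_mul him (by linarith) (by positivity) hz0.le

theorem nonlinearityBound_of_isHolomorphicExtension {g : CircleDeg1Lift} {G : ℂ → ℂ} {Δ ε : ℝ}
    (hΔ : 0 < Δ) (hε : 0 ≤ ε) (hg : IsAnalyticCircleDiffeo g) (hG : IsHolomorphicExtension g Δ G)
    (hN : nonlinearityNorm Δ G < ENNReal.ofReal ε) : NonlinearityBound g Δ ε G where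
  pos := hΔ
  map_real := hG.1
  differentiableOn := by
    obtain ⟨-, U, -, hU, hd, -⟩ := hG
    exact hd.mono hU
  norm_logDeriv_le z hz := by
    have h1 : ‖logDeriv (deriv G) z‖ₑ ≤ nonlinearityNorm Δ G :=
      le_iSup₂ (f := fun z _ => ‖logDeriv (deriv G) z‖ₑ) z hz
    have h2 := h1.trans hN.le
    rwa [← ofReal_norm, ENNReal.ofReal_le_ofReal_iff hε] at h2
  deriv_real_ne_zero x h0 := by
    obtain ⟨hreal, U, hUo, hU, hd, -⟩ := hG
    obtain ⟨-, k, hk, -, hka⟩ := hg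
    have h1 := (hd.differentiableAt (hUo.mem_nhds (hU (ofReal_mem_strip hΔ x)))).hasDerivAt
    have h2 : HasDerivAt g 0 x := by
      have := h1.real_of_complex
      simpa [hreal, h0] using this
    -- The inverse `k` is differentiable, so the chain rule for `k ∘ g = id` excludes `g' = 0`.
    have h3 := ((hka (g x) (mem_univ _)).differentiableAt.hasDerivAt).comp x h2
    rw [hk.comp_eq_id] at h3
    simpa using h3.unique (hasDerivAt_id x)

end CircleDynamics

theorem mainTheorem1 :
    ∃ ε₀ : ℝ, 0 < ε₀ ∧ ε₀ < 1 / 16 ∧ ∃ C₀ : ℝ, 0 < C₀ ∧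
      ∀ D₀ : ℝ, 4 < D₀ → D₀ < 1 / (4 * ε₀) →
      ∀ Δ : ℝ, 0 < Δ →
      ∀ (g : CircleDeg1Lift) (G : ℂ → ℂ),
        CircleDynamics.IsAnalyticCircleDiffeo g →
        Irrational g.translationNumber →
        CircleDynamics.IsHolomorphicExtension g Δ G →
        DiffContOnCl ℂ G (CircleDynamics.strip Δ) →
        CircleDynamics.nonlinearityNorm Δ G < ENNReal.ofReal ε₀ →
        (∃ h : ℝ ≃o ℝ, CircleDynamics.IsLinearization g h) ∧
        ∃ n₀ : ℕ, 1 ≤ n₀ ∧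
          ∀ h : ℝ ≃o ℝ, CircleDynamics.IsLinearization g h →
          ∀ n : ℕ, n₀ < n →
          ∀ (x₀ y₀ : ℝ) (z₀ : ℂ), 0 < y₀ → y₀ < D₀ →
            z₀ = ⟨x₀, |CircleDynamics.displacement g n x₀| * y₀⟩ →
          ∀ j : ℕ, j ≤ CircleDynamics.convDen g.translationNumber (n + 1) →
            (∀ i < j, G^[i] z₀ ∈ CircleDynamics.strip Δ) ∧
            ∃ (hG : 0 < (G^[j] z₀).im)
              (hφ : 0 < (CircleDynamics.complexFlow g h n (j : ℝ) z₀).im),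
              dist (⟨G^[j] z₀, hG⟩ : UpperHalfPlane)
                ⟨CircleDynamics.complexFlow g h n (j : ℝ) z₀, hφ⟩ ≤ C₀ := by
  refine ⟨1 / 32, by norm_num, by norm_num, 1, one_pos, ?_⟩
  intro D₀ hD4 hD Δ hΔ g G hg hα hGe _ hN
  have hG := CircleDynamics.nonlinearityBound_of_isHolomorphicExtension hΔ (by norm_num) hg hGe hN
  have hsurj : Function.Surjective g := by
    obtain ⟨-, k, -, hk, -⟩ := hg
    exact hk.surjective
  obtain ⟨h', hh'⟩ := hG.exists_isLinearization hsurj hα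
  refine ⟨⟨h', hh'⟩, ?_⟩
  have hD0 : 0 < D₀ := by linarith
  obtain ⟨n₀, hn₀, hsmall⟩ := hh'.exists_forall_abs_displacement_lt hα
    (show 0 < Δ / (8 / 5 * D₀) by positivity)
  refine ⟨n₀, hn₀, fun h hh n hn x y z hy0 hyD hz j hj => ?_⟩
  have hn' : ∀ t, 8 / 5 * D₀ * |CircleDynamics.displacement g n t| < Δ := fun t => by
    have := hsmall n hn t
    rwa [lt_div_iff₀ (by positivity), mul_comm] at this
  have hseg := hG.iterate_verticalSegment hh hα le_rfl hD0.le
    (by norm_num at hD; linarith) hn' x hj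
  have hm : 0 < |CircleDynamics.displacement g n x| :=
    abs_pos.2 (hh.displacement_ne_zero hα n x)
  have hs : |CircleDynamics.displacement g n x| * y ≤ |CircleDynamics.displacement g n x| * D₀ := by
    gcongr
  have hs0 : 0 < |CircleDynamics.displacement g n x| * y := by positivity
  subst hz
  refine ⟨(hseg _ (Complex.mem_reProdIm.2 ⟨Set.mem_singleton _, hs0.le, hs⟩)).1, ?_⟩
  have hφ : CircleDynamics.complexFlow g h n j ⟨x, |CircleDynamics.displacement g n x| * y⟩ =
      ⟨g^[j] x, |CircleDynamics.displacement g n (g^[j] x)| * y⟩ := by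
    simp only [CircleDynamics.complexFlow, hh.realFlow_natCast]
    rw [mul_div_cancel_left₀ _ hm.ne']
  obtain ⟨hc1, hc2⟩ := hG.abs_displacement_iterate_comparison hh hα hj x
  have hT := mul_pos (hG.orbitDeriv_pos j x) hs0
  simp only [hφ]
  refine CircleDynamics.dist_upperHalfPlane_le_one hT
    (hG.norm_iterate_sub_affine_le (fun w hw => (hseg w hw).2) hs0.le hs) ?_ ?_
  · calc _ ≤ Real.exp (1 / 32) * (CircleDynamics.orbitDeriv g j x *
            |CircleDynamics.displacement g n x|) * y := by gcongr
      _ = _ := by ring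
  · calc _ = CircleDynamics.orbitDeriv g j x * |CircleDynamics.displacement g n x| * y := by ring
      _ ≤ Real.exp (1 / 32) * |CircleDynamics.displacement g n (g^[j] x)| * y := by gcongr
      _ = _ := by ring
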